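/- Let $(X,\mathcal L,\lambda)$ be a measure space, where $\lambda$ is a non-negative, countably additive measure on the $\sigma$-algebra $\mathcal L$. A finitely additive measure on $\mathcal L$ is a function $\nu:\mathcal L\to\mathbb R$ with $\nu(\emptyset)=0$, $\sup_{A\in\mathcal L}|\nu(A)|<\infty$, and $\nu(A\cup B)=\nu(A)+\nu(B)$ for disjoint $A,B\in\mathcal L$; it is $\sigma$-additive if $\nu(\bigcup_k E_k)=\sum_k\nu(E_k)$ for every sequence $(E_k)$ of pairwise disjoint sets in $\mathcal L$. Inequalities between finitely additive measures are meant setwise on $\mathcal L$. A finitely additive measure $\nu\ge 0$ is purely finitely additive if the only $\sigma$-additive $\gamma$ with $0\le\gamma\le\nu$ is $\gamma=0$; a general $\nu$ is purely finitely additive if both $\nu^+$ and $\nu^-$ are, where $\nu^{\pm}(E)=\sup\{\pm\nu(F): F\in\mathcal L,\ F\subseteq E\}$. A set $A\in\mathcal L$ is a $\lambda$-atom if $\lambda(A)>0$ and $\lambda(E)\in\{0,\lambda(A)\}$ for every $E\in\mathcal L$ with $E\subseteq A$. Let $\mathfrak G$ be the set of finitely additive measures $\omega$ on $\mathcal L$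 such that $\omega(N)=0$ for all $N\in\mathcal L$ with $\lambda(N)=0$, $\omega(X)=1$, and $\omega(A)\in\{0,1\}$ for all $A\in\mathcal L$. Let $\omega\in\mathfrak G$. (a) Either $\omega$ is purely finitely additive or $\omega$ is $\sigma$-additive, and not both. (b) If $(X,\mathcal L,\lambda)$ is $\sigma$-finite and $\omega$ is $\sigma$-additive, then there exists a $\lambda$-atom $E_\omega$ with $\lambda(E_\omega)<\infty$ such that $\omega(E)=\lambda(E\cap E_\omega)/\lambda(E_\omega)$ for all $E\in\mathcal L$. -/

import Mathlib

open MeasureTheory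

noncomputable section

/-- A finitely additive measure on the `σ`-algebra of measurable subsets of `X`: a real-valued,
bounded, finitely additive set function. As for Mathlib's `VectorMeasure`, it is represented by a
function on all subsets which is `0` on the non-measurable ones, so that two such measures are
equal if and only if they agree on all measurable sets. -/
structure FinAddMeasure (X : Type*) [MeasurableSpace X] where
  toFun : Set X → ℝ
  empty' : toFun ∅ = 0
  bounded' : ∃ C : ℝ, ∀ A : Set X, MeasurableSet A → |toFun A| ≤ C
  union' : ∀ A B : Set X, MeasurableSet A → MeasurableSet B → A ∩ B = ∅ →
    toFun (A ∪ B) = toFun A + toFun B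
  not_measurable' : ∀ A : Set X, ¬ MeasurableSet A → toFun A = 0

namespace FinAddMeasure

variable {X : Type*} [MeasurableSpace X]

instance : CoeFun (FinAddMeasure X) (fun _ => Set X → ℝ) := ⟨toFun⟩

instance : Zero (FinAddMeasure X) :=
  ⟨{ toFun := fun _ => 0
     empty' := rfl
     bounded' := ⟨0, fun _ _ => by simp⟩
     union' := fun _ _ _ _ _ => by simp
     not_measurable' := fun _ _ => rfl }⟩

instance : Neg (FinAddMeasure X) :=
  ⟨fun ν =>
   { toFun := fun A => -ν A
     empty' := by simp [ν.empty']
     bounded' := by simpa using ν.bounded'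
     union' := fun A B hA hB h => by rw [ν.union' A B hA hB h]; ring
     not_measurable' := fun A hA => by simp [ν.not_measurable' A hA] }⟩

/-- `ν₁ ≤ ν₂` means `ν₁ A ≤ ν₂ A` for every measurable set `A`. -/
instance : LE (FinAddMeasure X) :=
  ⟨fun ν₁ ν₂ => ∀ A : Set X, MeasurableSet A → ν₁ A ≤ ν₂ A⟩

/-- The numbers `ν₁ F + ν₂ (E \ F)`, for `F ⊆ E` measurable. -/
def supSet (ν₁ ν₂ : FinAddMeasure X) (E : Set X) : Set ℝ :=
  {r | ∃ F : Set X, MeasurableSet F ∧ F ⊆ E ∧ r = ν₁ F + ν₂ (E \ F)}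

theorem abs_le_of_mem_supSet (ν₁ ν₂ : FinAddMeasure X) :
    ∃ C : ℝ, ∀ E, MeasurableSet E → ∀ r ∈ supSet ν₁ ν₂ E, |r| ≤ C := by
  obtain ⟨C₁, h₁⟩ := ν₁.bounded'
  obtain ⟨C₂, h₂⟩ := ν₂.bounded'
  refine ⟨C₁ + C₂, ?_⟩
  rintro E hE r ⟨F, hF, -, rfl⟩
  exact (abs_add_le _ _).trans (add_le_add (h₁ F hF) (h₂ _ (hE.diff hF)))

theorem supSet_nonempty (ν₁ ν₂ : FinAddMeasure X) (E : Set X) : (supSet ν₁ ν₂ E).Nonempty :=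
  ⟨_, ∅, MeasurableSet.empty, Set.empty_subset E, rfl⟩

theorem supSet_bddAbove (ν₁ ν₂ : FinAddMeasure X) {E : Set X} (hE : MeasurableSet E) :
    BddAbove (supSet ν₁ ν₂ E) := by
  obtain ⟨C, hC⟩ := abs_le_of_mem_supSet ν₁ ν₂
  exact ⟨C, fun r hr => (abs_le.1 (hC E hE r hr)).2⟩

theorem supSet_union (ν₁ ν₂ : FinAddMeasure X) {A B : Set X} (hA : MeasurableSet A)
    (hB : MeasurableSet B) (h : A ∩ B = ∅) :
    sSup (supSet ν₁ ν₂ (A ∪ B)) = sSup (supSet ν₁ ν₂ A) + sSup (supSet ν₁ ν₂ B) := by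
  have hd : ∀ x, x ∈ A → x ∈ B → False := fun x ha hb => by
    have : x ∈ A ∩ B := ⟨ha, hb⟩
    rw [h] at this
    exact this
  apply le_antisymm
  · refine csSup_le (supSet_nonempty ν₁ ν₂ _) ?_
    rintro r ⟨F, hF, hFE, rfl⟩
    have e₁ : F = (F ∩ A) ∪ (F ∩ B) := by
      rw [← Set.inter_union_distrib_left, Set.inter_eq_left.2 hFE]
    have e₂ : (A ∪ B) \ F = (A \ (F ∩ A)) ∪ (B \ (F ∩ B)) := by
      ext x
      simp only [Set.mem_sdiff, Set.mem_union, Set.mem_inter_iff]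
      tauto
    have k₁ : ν₁ F = ν₁ (F ∩ A) + ν₁ (F ∩ B) := by
      conv_lhs => rw [e₁]
      refine ν₁.union' _ _ (hF.inter hA) (hF.inter hB) ?_
      ext x
      exact ⟨fun hx => hd x hx.1.2 hx.2.2, fun hx => hx.elim⟩
    have k₂ : ν₂ ((A ∪ B) \ F) = ν₂ (A \ (F ∩ A)) + ν₂ (B \ (F ∩ B)) := by
      rw [e₂]
      refine ν₂.union' _ _ (hA.diff (hF.inter hA)) (hB.diff (hF.inter hB)) ?_
      ext x
      exact ⟨fun hx => hd x hx.1.1 hx.2.1, fun hx => hx.elim⟩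
    have l₁ := le_csSup (supSet_bddAbove ν₁ ν₂ hA)
      ⟨F ∩ A, hF.inter hA, Set.inter_subset_right, rfl⟩
    have l₂ := le_csSup (supSet_bddAbove ν₁ ν₂ hB)
      ⟨F ∩ B, hF.inter hB, Set.inter_subset_right, rfl⟩
    linarith
  · rw [← le_sub_iff_add_le]
    refine csSup_le (supSet_nonempty ν₁ ν₂ _) ?_
    rintro r ⟨F, hF, hFA, rfl⟩
    rw [le_sub_comm]
    refine csSup_le (supSet_nonempty ν₁ ν₂ _) ?_
    rintro s ⟨G, hG, hGB, rfl⟩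
    have e₂ : (A ∪ B) \ (F ∪ G) = (A \ F) ∪ (B \ G) := by
      ext x
      have := hd x
      have := @hFA x
      have := @hGB x
      simp only [Set.mem_sdiff, Set.mem_union]
      tauto
    have k₁ : ν₁ (F ∪ G) = ν₁ F + ν₁ G := by
      refine ν₁.union' _ _ hF hG ?_
      ext x
      exact ⟨fun hx => hd x (hFA hx.1) (hGB hx.2), fun hx => hx.elim⟩
    have k₂ : ν₂ ((A ∪ B) \ (F ∪ G)) = ν₂ (A \ F) + ν₂ (B \ G) := by
      rw [e₂]
      refine ν₂.union' _ _ (hA.diff hF) (hB.diff hG) ?_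
      ext x
      exact ⟨fun hx => hd x hx.1.1 hx.2.1, fun hx => hx.elim⟩
    have l := le_csSup (supSet_bddAbove ν₁ ν₂ (hA.union hB))
      ⟨F ∪ G, hF.union hG, Set.union_subset_union hFA hGB, rfl⟩
    linarith

open Classical in
/-- The lattice supremum `ν₁ ∨ ν₂`, given on measurable `E` by
`(ν₁ ∨ ν₂) E = sup {ν₁ F + ν₂ (E \ F) : F ⊆ E measurable}`. -/
def sup (ν₁ ν₂ : FinAddMeasure X) : FinAddMeasure X where
  toFun E := if MeasurableSet E then sSup (supSet ν₁ ν₂ E) else 0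
  empty' := by
    have : supSet ν₁ ν₂ ∅ = {0} := by
      ext r
      constructor
      · rintro ⟨F, -, hF, rfl⟩
        have hF' : F = ∅ := Set.subset_empty_iff.1 hF
        subst hF'
        simp [ν₁.empty', ν₂.empty']
      · rintro rfl
        exact ⟨∅, MeasurableSet.empty, le_rfl, by simp [ν₁.empty', ν₂.empty']⟩
    simp [this]
  bounded' := by
    obtain ⟨C, hC⟩ := abs_le_of_mem_supSet ν₁ ν₂
    refine ⟨C, fun A hA => ?_⟩
    rw [if_pos hA]
    obtain ⟨r, hr⟩ := supSet_nonempty ν₁ ν₂ A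
    exact abs_le.2 ⟨(abs_le.1 (hC A hA r hr)).1.trans (le_csSup (supSet_bddAbove ν₁ ν₂ hA) hr),
      csSup_le ⟨r, hr⟩ fun s hs => (abs_le.1 (hC A hA s hs)).2⟩
  union' A B hA hB h := by
    rw [if_pos hA, if_pos hB, if_pos (hA.union hB), supSet_union ν₁ ν₂ hA hB h]
  not_measurable' A hA := if_neg hA

/-- The positive part `ν⁺ = ν ∨ 0`. -/
def posPart (ν : FinAddMeasure X) : FinAddMeasure X := ν.sup 0

/-- The negative part `ν⁻ = (-ν) ∨ 0`. -/
def negPart (ν : FinAddMeasure X) : FinAddMeasure X := (-ν).sup 0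

/-- `ν` is `σ`-additive. -/
def IsSigmaAdditive (ν : FinAddMeasure X) : Prop :=
  ∀ E : ℕ → Set X, (∀ k, MeasurableSet (E k)) → (∀ j k, j ≠ k → E j ∩ E k = ∅) →
    HasSum (fun k => ν (E k)) (ν (⋃ k, E k))

/-- For a non-negative `ν`: the only `σ`-additive `γ` with `0 ≤ γ ≤ ν` is `γ = 0`. -/
def HasNoSigmaAdditiveMinorant (ν : FinAddMeasure X) : Prop :=
  {γ : FinAddMeasure X | γ.IsSigmaAdditive ∧ 0 ≤ γ ∧ γ ≤ ν} = {0}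

/-- `ν` is purely finitely additive: neither of the non-negative measures `ν⁺` and `ν⁻` has a
non-zero `σ`-additive minorant `γ ≥ 0`. (If `ν ≥ 0`, then `ν⁺ = ν` and `ν⁻ = 0`.) -/
def IsPurelyFinitelyAdditive (ν : FinAddMeasure X) : Prop :=
  ν.posPart.HasNoSigmaAdditiveMinorant ∧ ν.negPart.HasNoSigmaAdditiveMinorant

/-- The finitely additive measures that vanish on all `μ`-null measurable sets; they represent
the dual of `L_∞(μ)`. -/
def dualLInfty (μ : Measure X) : Set (FinAddMeasure X) :=
  {ν | ∀ N : Set X, MeasurableSet N → μ N = 0 → ν N = 0}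

/-- The `0`-`1` measures in `dualLInfty μ`. -/
def zeroOne (μ : Measure X) : Set (FinAddMeasure X) :=
  {ω | ω ∈ dualLInfty μ ∧ ω Set.univ = 1 ∧ ∀ A : Set X, MeasurableSet A → ω A = 0 ∨ ω A = 1}

/-- `A` is a `μ`-atom. -/
def IsMeasureAtom (μ : Measure X) (A : Set X) : Prop :=
  MeasurableSet A ∧ 0 < μ A ∧
    ∀ E : Set X, MeasurableSet E → E ⊆ A → μ E = 0 ∨ μ E = μ A

end FinAddMeasure

end

namespace FinAddMeasure

variable {X : Type*} [MeasurableSpace X]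

/-! If a 0-1 measure `ω` is not σ-additive, there are `ω`-null sets whose countable union `U` is
full (`exists_null_seq_of_not_isSigmaAdditive`). A σ-additive `γ` with `0 ≤ γ ≤ ω` vanishes on `U`,
and also on `Uᶜ`, so `γ = 0`. If `ω` is σ-additive, it is its own non-zero minorant. For the atom,
full sets are stable under countable intersection, so some full `A` has least `μ`-measure
(`exists_minimal_measure`). It is finite by σ-finiteness and positive because `ω` vanishes on
`μ`-null sets. For `F ⊆ A`, one of `F`, `A \ F` is full, hence has measure `μ A` by minimality, and
the other is `μ`-null. -/

theorem ext_of_measurable {ν₁ ν₂ : FinAddMeasure X}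
    (h : ∀ A, MeasurableSet A → ν₁ A = ν₂ A) : ν₁ = ν₂ := by
  have hf : ν₁.toFun = ν₂.toFun := by
    funext A
    by_cases hA : MeasurableSet A
    · exact h A hA
    · rw [ν₁.not_measurable' A hA, ν₂.not_measurable' A hA]
  cases ν₁
  cases ν₂
  cases hf
  rfl

theorem zero_apply (A : Set X) : (0 : FinAddMeasure X) A = 0 := rfl

theorem neg_apply (ν : FinAddMeasure X) (A : Set X) : (-ν) A = -ν A := rfl

theorem apply_nonneg {ν : FinAddMeasure X} (hν : 0 ≤ ν) {A : Set X} (hA : MeasurableSet A) :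
    0 ≤ ν A := hν A hA

theorem apply_add_diff (ν : FinAddMeasure X) {A B : Set X} (hA : MeasurableSet A)
    (hB : MeasurableSet B) (h : A ⊆ B) : ν A + ν (B \ A) = ν B := by
  rw [← ν.union' A (B \ A) hA (hB.diff hA) (Set.inter_sdiff_self A B),
    Set.union_sdiff_cancel h]

theorem apply_mono {ν : FinAddMeasure X} (hν : 0 ≤ ν) {A B : Set X} (hA : MeasurableSet A)
    (hB : MeasurableSet B) (h : A ⊆ B) : ν A ≤ ν B := by
  linarith [ν.apply_add_diff hA hB h, apply_nonneg hν (hB.diff hA)]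

theorem apply_add_compl (ν : FinAddMeasure X) {A : Set X} (hA : MeasurableSet A) :
    ν A + ν Aᶜ = ν Set.univ := by
  rw [Set.compl_eq_univ_sdiff]
  exact ν.apply_add_diff hA MeasurableSet.univ (Set.subset_univ A)

theorem eq_zero_of_apply_univ {ν : FinAddMeasure X} (hν : 0 ≤ ν) (h : ν Set.univ = 0) :
    ν = 0 :=
  ext_of_measurable fun A hA => le_antisymm
    ((apply_mono hν hA MeasurableSet.univ (Set.subset_univ A)).trans_eq h) (apply_nonneg hν hA)

theorem posPart_eq_self {ν : FinAddMeasure X} (hν : 0 ≤ ν) : ν.posPart = ν := by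
  refine ext_of_measurable fun A hA => (if_pos hA).trans (le_antisymm ?_ ?_)
  · refine csSup_le (supSet_nonempty _ _ _) ?_
    rintro r ⟨F, hF, hFA, rfl⟩
    rw [zero_apply, add_zero]
    exact apply_mono hν hF hA hFA
  · refine le_csSup (supSet_bddAbove _ _ hA) ⟨A, hA, le_rfl, ?_⟩
    rw [zero_apply, add_zero]

theorem negPart_eq_zero {ν : FinAddMeasure X} (hν : 0 ≤ ν) : ν.negPart = 0 := by
  refine ext_of_measurable fun A hA => (if_pos hA).trans (le_antisymm ?_ ?_)
  · refine csSup_le (supSet_nonempty _ _ _) ?_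
    rintro r ⟨F, hF, -, rfl⟩
    rw [zero_apply, zero_apply, add_zero, neg_apply]
    exact neg_nonpos.2 (apply_nonneg hν hF)
  · refine le_csSup (supSet_bddAbove _ _ hA) ⟨∅, MeasurableSet.empty, Set.empty_subset A, ?_⟩
    rw [zero_apply, zero_apply, neg_apply, ν.empty', neg_zero, add_zero]

theorem isSigmaAdditive_zero : (0 : FinAddMeasure X).IsSigmaAdditive :=
  fun _ _ _ => hasSum_zero

theorem hasNoSigmaAdditiveMinorant_iff {ν : FinAddMeasure X} (hν : 0 ≤ ν) :
    ν.HasNoSigmaAdditiveMinorant ↔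
      ∀ γ : FinAddMeasure X, γ.IsSigmaAdditive → 0 ≤ γ → γ ≤ ν → γ = 0 := by
  constructor
  · intro h γ h₁ h₂ h₃
    have : γ ∈ {γ : FinAddMeasure X | γ.IsSigmaAdditive ∧ 0 ≤ γ ∧ γ ≤ ν} := ⟨h₁, h₂, h₃⟩
    rw [h] at this
    exact this
  · intro h
    refine Set.eq_singleton_iff_unique_mem.2 ⟨⟨isSigmaAdditive_zero, fun _ _ => le_rfl, hν⟩, ?_⟩
    rintro γ ⟨h₁, h₂, h₃⟩
    exact h γ h₁ h₂ h₃

theorem isPurelyFinitelyAdditive_iff {ν : FinAddMeasure X} (hν : 0 ≤ ν) :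
    ν.IsPurelyFinitelyAdditive ↔
      ∀ γ : FinAddMeasure X, γ.IsSigmaAdditive → 0 ≤ γ → γ ≤ ν → γ = 0 := by
  rw [IsPurelyFinitelyAdditive, posPart_eq_self hν, negPart_eq_zero hν,
    hasNoSigmaAdditiveMinorant_iff hν, hasNoSigmaAdditiveMinorant_iff fun _ _ => le_rfl]
  refine and_iff_left fun γ _ h₀ h₁ => ext_of_measurable fun A hA => ?_
  exact le_antisymm (h₁ A hA) (h₀ A hA)

/-- Disjointing the sequence only shrinks its terms, so they stay null. Both halves of the theorem
exploit σ-additivity in this form. -/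
theorem IsSigmaAdditive.iUnion_eq_zero {ν : FinAddMeasure X} (h : ν.IsSigmaAdditive)
    (hν : 0 ≤ ν) {N : ℕ → Set X} (hN : ∀ k, MeasurableSet (N k)) (h₀ : ∀ k, ν (N k) = 0) :
    ν (⋃ k, N k) = 0 := by
  have hm : ∀ k, MeasurableSet (disjointed N k) := fun k => MeasurableSet.disjointed hN k
  have hz : ∀ k, ν (disjointed N k) = 0 := fun k => le_antisymm
    ((apply_mono hν (hm k) (hN k) (disjointed_subset N k)).trans_eq (h₀ k))
    (apply_nonneg hν (hm k))
  have hs := h (disjointed N) hm fun j k hjk =>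
    Set.disjoint_iff_inter_eq_empty.1 (disjoint_disjointed N hjk)
  simp only [hz, iUnion_disjointed] at hs
  exact hs.unique hasSum_zero

/-! ### The dichotomy for 0-1 measures. -/

section ZeroOne

variable {μ : Measure X} {ω : FinAddMeasure X}

theorem nonneg_of_mem_zeroOne (hω : ω ∈ zeroOne μ) : 0 ≤ ω := by
  intro A hA
  rcases hω.2.2 A hA with h | h <;> rw [h, zero_apply]
  exact zero_le_one

/-- Failure of `σ`-additivity of a `0`-`1` measure is witnessed by null sets with a union of
full measure. -/
theorem exists_null_seq_of_not_isSigmaAdditive (hω : ω ∈ zeroOne μ) (h : ¬ ω.IsSigmaAdditive) :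
    ∃ E : ℕ → Set X, (∀ k, MeasurableSet (E k)) ∧ (∀ k, ω (E k) = 0) ∧ ω (⋃ k, E k) = 1 := by
  have hν := nonneg_of_mem_zeroOne hω
  simp only [IsSigmaAdditive, not_forall] at h
  obtain ⟨E, hE, hd, hs⟩ := h
  have hU : MeasurableSet (⋃ k, E k) := MeasurableSet.iUnion hE
  have h₀ : ∀ k, ω (E k) = 0 := by
    intro k
    -- If one term has mass 1, the total mass 1 forces the disjoint others to be null; the series
    -- then has a single term, equal to the mass of the union.
    refine (hω.2.2 _ (hE k)).resolve_right fun hk => hs ?_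
    have hU1 : ω (⋃ k, E k) = ω (E k) := by
      have := apply_mono hν (hE k) hU (Set.subset_iUnion E k)
      rcases hω.2.2 _ hU with h | h <;> linarith
    rw [hU1]
    refine hasSum_single k fun j hj => ?_
    have hu := ω.union' _ _ (hE j) (hE k) (hd j k hj)
    have := apply_mono hν ((hE j).union (hE k)) MeasurableSet.univ (Set.subset_univ _)
    rw [hω.2.1] at this
    linarith [apply_nonneg hν (hE j)]
  refine ⟨E, hE, h₀, (hω.2.2 _ hU).resolve_left fun hz => hs ?_⟩
  simp only [h₀, hz]
  exact hasSum_zero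

theorem isPurelyFinitelyAdditive_of_not_isSigmaAdditive (hω : ω ∈ zeroOne μ)
    (h : ¬ ω.IsSigmaAdditive) : ω.IsPurelyFinitelyAdditive := by
  obtain ⟨E, hE, h₀, h₁⟩ := exists_null_seq_of_not_isSigmaAdditive hω h
  have hU : MeasurableSet (⋃ k, E k) := MeasurableSet.iUnion hE
  refine (isPurelyFinitelyAdditive_iff (nonneg_of_mem_zeroOne hω)).2 fun γ hγ hγ₀ hγω => ?_
  refine eq_zero_of_apply_univ hγ₀ (le_antisymm ?_ (apply_nonneg hγ₀ MeasurableSet.univ))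
  have hγU : γ (⋃ k, E k) = 0 := hγ.iUnion_eq_zero hγ₀ hE fun k =>
    le_antisymm ((hγω _ (hE k)).trans_eq (h₀ k)) (apply_nonneg hγ₀ (hE k))
  -- The union is full, so its complement is `ω`-null and hence `γ`-null.
  linarith [γ.apply_add_compl hU, ω.apply_add_compl hU, hγω _ hU.compl, hω.2.1]

theorem not_isPurelyFinitelyAdditive_of_isSigmaAdditive (hω : ω ∈ zeroOne μ)
    (h : ω.IsSigmaAdditive) : ¬ ω.IsPurelyFinitelyAdditive := by
  intro hp
  have hν := nonneg_of_mem_zeroOne hω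
  have hz := (isPurelyFinitelyAdditive_iff hν).1 hp ω h hν fun _ _ => le_rfl
  have h1 := hω.2.1
  rw [hz, zero_apply] at h1
  exact zero_ne_one h1

/-! ### The atom of a σ-additive 0-1 measure. -/

theorem exists_measure_lt_top_apply_eq_one [SigmaFinite μ] (hω : ω ∈ zeroOne μ)
    (h : ω.IsSigmaAdditive) : ∃ B, MeasurableSet B ∧ μ B < ⊤ ∧ ω B = 1 := by
  by_contra! hB
  have hz : ω (⋃ n, spanningSets μ n) = 0 :=
    h.iUnion_eq_zero (nonneg_of_mem_zeroOne hω) (measurableSet_spanningSets μ) fun n =>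
      (hω.2.2 _ (measurableSet_spanningSets μ n)).resolve_right
        (hB _ (measurableSet_spanningSets μ n) (measure_spanningSets_lt_top μ n))
  rw [iUnion_spanningSets, hω.2.1] at hz
  exact one_ne_zero hz

theorem iInter_eq_one (hω : ω ∈ zeroOne μ) (h : ω.IsSigmaAdditive) {A : ℕ → Set X}
    (hA : ∀ n, MeasurableSet (A n)) (h₁ : ∀ n, ω (A n) = 1) : ω (⋂ n, A n) = 1 := by
  have hz : ω (⋃ n, (A n)ᶜ) = 0 :=
    h.iUnion_eq_zero (nonneg_of_mem_zeroOne hω) (fun n => (hA n).compl) fun n => by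
      linarith [ω.apply_add_compl (hA n), h₁ n, hω.2.1]
  rw [← Set.compl_iInter] at hz
  linarith [ω.apply_add_compl (MeasurableSet.iInter hA), hω.2.1]

/-- Among the sets of full `ω`-measure there is one of least `μ`-measure. -/
theorem exists_minimal_measure (hω : ω ∈ zeroOne μ) (h : ω.IsSigmaAdditive) :
    ∃ A, MeasurableSet A ∧ ω A = 1 ∧ ∀ B, MeasurableSet B → ω B = 1 → μ A ≤ μ B := by
  let S : Set ENNReal := {r | ∃ B, MeasurableSet B ∧ ω B = 1 ∧ μ B = r}
  have hS : S.Nonempty := ⟨_, Set.univ, MeasurableSet.univ, hω.2.1, rfl⟩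
  obtain ⟨u, -, hu, huS⟩ := exists_seq_tendsto_sInf hS (OrderBot.bddBelow S)
  choose A hA h₁ hAu using huS
  -- Monotonicity alone bounds the intersection of a minimising sequence by the infimum, so
  -- finiteness of `μ` plays no role.
  refine ⟨⋂ n, A n, MeasurableSet.iInter hA, iInter_eq_one hω h hA h₁, fun B hB hB₁ => ?_⟩
  calc μ (⋂ n, A n) ≤ sInf S :=
        ge_of_tendsto' hu fun n => (measure_mono (Set.iInter_subset A n)).trans_eq (hAu n)
    _ ≤ μ B := sInf_le ⟨B, hB, hB₁, rfl⟩

theorem exists_isMeasureAtom_of_isSigmaAdditive [SigmaFinite μ] (hω : ω ∈ zeroOne μ)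
    (h : ω.IsSigmaAdditive) : ∃ A : Set X, IsMeasureAtom μ A ∧ μ A < ⊤ ∧
      ∀ E : Set X, MeasurableSet E → ω E = (μ (E ∩ A)).toReal / (μ A).toReal := by
  obtain ⟨B, hB, hBtop, hB₁⟩ := exists_measure_lt_top_apply_eq_one hω h
  obtain ⟨A, hA, hA₁, hmin⟩ := exists_minimal_measure hω h
  have htop : μ A < ⊤ := (hmin B hB hB₁).trans_lt hBtop
  have hpos : μ A ≠ 0 := fun h₀ => one_ne_zero (hA₁.symm.trans (hω.1 A hA h₀))
  have hfull : ∀ F, MeasurableSet F → F ⊆ A → ω F = 1 → μ F = μ A := fun F hF hFA hF₁ =>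
    le_antisymm (measure_mono hFA) (hmin F hF hF₁)
  have hnull : ∀ F, MeasurableSet F → F ⊆ A → ω F = 0 → μ F = 0 := by
    intro F hF hFA hF₀
    have hd := hfull (A \ F) (hA.diff hF) Set.sdiff_subset
      (by linarith [ω.apply_add_diff hF hA hFA])
    have hadd := measure_sdiff_add_inter (μ := μ) A hF
    rw [hd, Set.inter_eq_right.2 hFA] at hadd
    -- Cancelling `μ A` from `μ A + μ F = μ A` requires `μ A` to be finite.
    exact (ENNReal.add_right_inj htop.ne).1 (hadd.trans (add_zero _).symm)
  refine ⟨A, ⟨hA, pos_iff_ne_zero.2 hpos, fun F hF hFA =>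
    (hω.2.2 F hF).imp (hnull F hF hFA) (hfull F hF hFA)⟩, htop, fun E hE => ?_⟩
  have hEA := hE.inter hA
  have hν := nonneg_of_mem_zeroOne hω
  -- The rest of `E` lies in the `ω`-null set `Aᶜ`.
  have hE' : ω E = ω (E ∩ A) := by
    have h₁ := ω.apply_add_diff hEA hE Set.inter_subset_left
    rw [Set.sdiff_self_inter] at h₁
    have h₂ := apply_mono hν (hE.diff hA) hA.compl fun x hx => hx.2
    linarith [ω.apply_add_compl hA, hω.2.1, apply_nonneg hν (hE.diff hA)]
  rw [hE']
  rcases hω.2.2 _ hEA with h₀ | h₁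
  · rw [h₀, hnull _ hEA Set.inter_subset_right h₀, ENNReal.toReal_zero, zero_div]
  · rw [h₁, hfull _ hEA Set.inter_subset_right h₁,
      div_self (ENNReal.toReal_ne_zero.2 ⟨hpos, htop.ne⟩)]

end ZeroOne

end FinAddMeasure

theorem theorem2p4 {X : Type*} [MeasurableSpace X] (μ : Measure X)
    (ω : FinAddMeasure X) (hω : ω ∈ FinAddMeasure.zeroOne μ) :
    ((ω.IsPurelyFinitelyAdditive ∨ ω.IsSigmaAdditive) ∧
      ¬ (ω.IsPurelyFinitelyAdditive ∧ ω.IsSigmaAdditive)) ∧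
    (SigmaFinite μ → ω.IsSigmaAdditive →
      ∃ A : Set X, FinAddMeasure.IsMeasureAtom μ A ∧ μ A < ⊤ ∧
        ∀ E : Set X, MeasurableSet E → ω E = (μ (E ∩ A)).toReal / (μ A).toReal) := by
  refine ⟨⟨?_, fun h =>
    FinAddMeasure.not_isPurelyFinitelyAdditive_of_isSigmaAdditive hω h.2 h.1⟩, ?_⟩
  · by_cases h : ω.IsSigmaAdditive
    · exact Or.inr h
    · exact Or.inl (FinAddMeasure.isPurelyFinitelyAdditive_of_not_isSigmaAdditive hω h)
  · intro _ h
    exact FinAddMeasure.exists_isMeasureAtom_of_isSigmaAdditive hω h
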